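/- Let $M$ be a finite von Neumann algebra with a faithful normal trace $\tau$, $\tau(1)=1$, and let $B\subseteq M$ be a von Neumann subalgebra with the same unit. Let $M$ act by left multiplication on the Hilbert space $L^2(M,\tau)$, the completion of $M$ for the inner product $\langle x,y\rangle=\tau(x^*y)$ (conjugate linear in the first variable); write $\xi\in L^2(M,\tau)$ for the vector given by $1\in M$, let $e_B$ be the orthogonal projection of $L^2(M,\tau)$ onto the closure of $B\xi$, and let $\langle M,e_B\rangle$ be the von Neumann algebra on $L^2(M,\tau)$ generated by $M$ and $e_B$. Suppose that $B'\cap M\subseteq B$, and let $v\in M$ be an intertwiner of $B$, that is, a partial isometry with $vBv^*\subseteq B$ and $v^*v\in B$. Then $v^*e_Bv$ is a projection, it belongs to $(B'\cap\langle M,e_B\rangle)v^*v=\{xv^*v : x\in B'\cap\langle M,e_B\rangle\}$, and it commutes with every element of $(B'\cap\langle M,e_B\rangle)v^*v$; in other words, $v^*e_Bv$ is a central projection of $(B'\cap\langle M,e_B\rangle)v^*v$. -/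

import Mathlib

open scoped ComplexOrder InnerProductSpace

noncomputable section

namespace BasicConstruction

universe u

variable {K : Type u} [NormedAddCommGroup K] [InnerProductSpace ℂ K] [CompleteSpace K]

/-- The von Neumann algebra on `K` generated by a set `s` of bounded operators: the double
commutant of `s ∪ s*`. -/
def generated (s : Set (K →L[ℂ] K)) : VonNeumannAlgebra K where
  toStarSubalgebra := StarSubalgebra.centralizer ℂ (StarSubalgebra.centralizer ℂ s : Set (K →L[ℂ] K))
  centralizer_centralizer' := by
    change Set.centralizer (Set.centralizer
      ((StarSubalgebra.centralizer ℂ (StarSubalgebra.centralizer ℂ s : Set (K →L[ℂ] K)) :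
        StarSubalgebra ℂ (K →L[ℂ] K)) : Set (K →L[ℂ] K))) =
      ((StarSubalgebra.centralizer ℂ (StarSubalgebra.centralizer ℂ s : Set (K →L[ℂ] K)) :
        StarSubalgebra ℂ (K →L[ℂ] K)) : Set (K →L[ℂ] K))
    rw [StarSubalgebra.coe_centralizer]
    exact Set.centralizer_centralizer_centralizer _

/-- The elements of a von Neumann algebra, as a type. -/
abbrev Elem (M : VonNeumannAlgebra K) : Type u := M.toStarSubalgebra

instance isClosed_coe (M : VonNeumannAlgebra K) :
    IsClosed (M.toStarSubalgebra : Set (K →L[ℂ] K)) := by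
  rw [VonNeumannAlgebra.coe_toStarSubalgebra, ← M.centralizer_centralizer]
  exact Set.isClosed_centralizer _

/-- The order on a von Neumann algebra, for which the nonnegative elements are the `x* x`. -/
instance instPartialOrder (M : VonNeumannAlgebra K) : PartialOrder (Elem M) :=
  CStarAlgebra.spectralOrder (Elem M)

instance instStarOrderedRing (M : VonNeumannAlgebra K) : StarOrderedRing (Elem M) :=
  CStarAlgebra.spectralOrderedRing (Elem M)

/-- A faithful normal trace `τ` on `M` with `τ 1 = 1`. Normality is ultraweak continuity:
`τ` is of the form `x ↦ ∑ i, ⟪ζ i, x (η i)⟫` with square-summable sequences of vectors. -/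
structure FaithfulNormalTrace (M : VonNeumannAlgebra K) where
  toLinearMap : Elem M →ₗ[ℂ] ℂ
  map_one : toLinearMap 1 = 1
  nonneg : ∀ x, 0 ≤ toLinearMap (star x * x)
  tracial : ∀ x y, toLinearMap (x * y) = toLinearMap (y * x)
  faithful : ∀ x, toLinearMap (star x * x) = 0 → x = 0
  normal : ∃ ζ η : ℕ → K, Summable (fun i => ‖ζ i‖ ^ 2) ∧ Summable (fun i => ‖η i‖ ^ 2) ∧
    ∀ x : Elem M, HasSum (fun i => ⟪ζ i, (x : K →L[ℂ] K) (η i)⟫_ℂ) (toLinearMap x)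

variable {M : VonNeumannAlgebra K}

/-- The trace as a positive linear functional. -/
def FaithfulNormalTrace.toPositive (τ : FaithfulNormalTrace M) : Elem M →ₚ[ℂ] ℂ :=
  PositiveLinearMap.mk₀ τ.toLinearMap fun x hx => by
    obtain ⟨y, rfl⟩ := CStarAlgebra.nonneg_iff_eq_star_mul_self.mp hx
    exact τ.nonneg y

/-- `L²(M, τ)`: the completion of `M` for the inner product `⟪x, y⟫ = τ (x* y)`. -/
abbrev L2 (τ : FaithfulNormalTrace M) : Type u := τ.toPositive.GNS

/-- The vector `x ξ` of `L²(M, τ)` given by `x ∈ M`. -/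
def toL2 (τ : FaithfulNormalTrace M) : Elem M →ₗ[ℂ] L2 τ :=
  (UniformSpace.Completion.toComplL (𝕜 := ℂ) (E := τ.toPositive.PreGNS)).toLinearMap ∘ₗ
    τ.toPositive.toPreGNS.toLinearMap

/-- The standard representation of `M` on `L²(M, τ)` by left multiplication. -/
def lmul (τ : FaithfulNormalTrace M) : Elem M →⋆ₐ[ℂ] (L2 τ →L[ℂ] L2 τ) :=
  τ.toPositive.gnsStarAlgHom

/-- `L²(B)`: the closure in `L²(M, τ)` of the vectors `b ξ`, `b ∈ B` (for `B ⊆ M`). -/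
def L2Sub (τ : FaithfulNormalTrace M) (B : VonNeumannAlgebra K) : Submodule ℂ (L2 τ) :=
  (Submodule.span ℂ {η : L2 τ | ∃ b : Elem M, (b : K →L[ℂ] K) ∈ B ∧ η = toL2 τ b}).topologicalClosure

instance instCompleteL2Sub (τ : FaithfulNormalTrace M) (B : VonNeumannAlgebra K) :
    CompleteSpace (L2Sub τ B) :=
  (Submodule.isClosed_topologicalClosure _).completeSpace_coe

/-- The Jones projection `e_B`: the orthogonal projection of `L²(M, τ)` onto `L²(B)`. -/
def jones (τ : FaithfulNormalTrace M) (B : VonNeumannAlgebra K) : L2 τ →L[ℂ] L2 τ :=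
  (L2Sub τ B).starProjection

/-- The basic construction `⟨M, e_B⟩`: the von Neumann algebra on `L²(M, τ)` generated by `M`
and `e_B`. -/
def basic (τ : FaithfulNormalTrace M) (B : VonNeumannAlgebra K) : VonNeumannAlgebra (L2 τ) :=
  generated (Set.range (lmul τ) ∪ {jones τ B})

/-- `B' ∩ ⟨M, e_B⟩`. -/
def relComm (τ : FaithfulNormalTrace M) (B : VonNeumannAlgebra K) : Set (L2 τ →L[ℂ] L2 τ) :=
  Set.centralizer (lmul τ '' {b : Elem M | (b : K →L[ℂ] K) ∈ B}) ∩ basic τ B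

/-- The cutdown `(B' ∩ ⟨M, e_B⟩) p` by `p ∈ M`. -/
def cutdown (τ : FaithfulNormalTrace M) (B : VonNeumannAlgebra K) (p : Elem M) :
    Set (L2 τ →L[ℂ] L2 τ) :=
  {y | ∃ x ∈ relComm τ B, y = x * lmul τ p}

/-- The operator `v* e_B v` on `L²(M, τ)`, for `v ∈ M`. -/
def conjJones (τ : FaithfulNormalTrace M) (B : VonNeumannAlgebra K) (v : Elem M) :
    L2 τ →L[ℂ] L2 τ :=
  lmul τ (star v) * jones τ B * lmul τ v

/-- The intertwiners of `B` in `M`: the partial isometries `v ∈ M` with `v B v* ⊆ B` and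
`v* v ∈ B`. -/
structure IsIntertwiner (B : VonNeumannAlgebra K) (v : Elem M) : Prop where
  partialIsometry : v * star v * v = v
  conj_mem : ∀ b ∈ B, (v : K →L[ℂ] K) * b * star (v : K →L[ℂ] K) ∈ B
  source_mem : star (v : K →L[ℂ] K) * (v : K →L[ℂ] K) ∈ B

end BasicConstruction

end

/-!
Write `p = v* v` and `f = v* e_B v`. Since `e_B` commutes with `v B v* ⊆ B`, `f` commutes with the
corner `p B p`. Any `y` in a von Neumann algebra `P ⊇ B` that commutes with `p B p` satisfies
`x p = y p` for some `x ∈ B' ∩ P`: for unitary `y`, take `b p k ↦ b p y k` on `B p H` and `0` on its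
orthogonal complement. With `P = ⟨M, e_B⟩` and `y = f` this puts `f = f p` in
`(B' ∩ ⟨M, e_B⟩) p`.

Let `x ∈ B' ∩ ⟨M, e_B⟩` and `η = x (v* ξ)`. As `x` also commutes with right multiplication by `B`,
the vector `ω = η v` satisfies `p ω = ω` and commutes with `N = B ∩ {p}'`. Averaging over the
unitaries of `N` shows that `ω` is a limit of vectors `y ξ` with `y ∈ N' ∩ M`. Such a `y` commutes
with `p B p`, so `y p = x' p` for some `x' ∈ B' ∩ M ⊆ B`; hence `ω ∈ L²(B)`. Then
`v η = v ω v* ∈ L²(B)`, that is, `f η = η`, and right multiplication by `B` extends this to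
`f x f = x f`. The same equation for `x*` gives `f x = x f`.
-/

noncomputable section

namespace BasicConstruction

theorem commute_of_mul_mul_eq {R : Type*} [Semigroup R] [StarMul R] {p x : R}
    (hp : IsSelfAdjoint p) (h : p * x * p = x * p) (h' : p * star x * p = star x * p) :
    Commute p x := by
  have hadj := congrArg star h'
  simp only [star_mul, star_star, hp.star_eq] at hadj
  rw [← mul_assoc] at hadj
  exact hadj.symm.trans h

theorem commute_conj_of_commute {R : Type*} [Semigroup R] {v w e b : R} (hv : v * w * v = v)
    (hw : w * v * w = w) (he : Commute e (v * b * w)) :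
    Commute (w * e * v) (w * v * b * (w * v)) := by
  calc w * e * v * (w * v * b * (w * v)) = w * e * (v * w * v) * b * w * v := by
        simp only [mul_assoc]
    _ = w * (e * (v * b * w)) * v := by rw [hv]; simp only [mul_assoc]
    _ = w * v * b * (w * v * w) * e * v := by rw [he.eq, hw]; simp only [mul_assoc]
    _ = w * v * b * (w * v) * (w * e * v) := by simp only [mul_assoc]

section Operators

variable {𝕜 H : Type*} [RCLike 𝕜] [NormedAddCommGroup H] [InnerProductSpace 𝕜 H]

theorem apply_comm_of_commute {S T : H →L[𝕜] H} (h : Commute S T) (z : H) :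
    S (T z) = T (S z) :=
  DFunLike.congr_fun h.eq z

variable [CompleteSpace H]

theorem inner_apply_apply (S T : H →L[𝕜] H) (v w : H) :
    ⟪S v, T w⟫_𝕜 = ⟪v, (star S * T) w⟫_𝕜 := by
  rw [mul_apply_eq_comp, ContinuousLinearMap.star_eq_adjoint,
    ContinuousLinearMap.adjoint_inner_right]

theorem commute_starProjection {U : Submodule 𝕜 H} [U.HasOrthogonalProjection] {T : H →L[𝕜] H}
    (h : ∀ x ∈ U, T x ∈ U) (h' : ∀ x ∈ U, star T x ∈ U) : Commute U.starProjection T := by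
  have compress : ∀ {S : H →L[𝕜] H}, (∀ x ∈ U, S x ∈ U) →
      U.starProjection * S * U.starProjection = S * U.starProjection := fun hS =>
    ContinuousLinearMap.ext fun x =>
      Submodule.starProjection_eq_self_iff.mpr (hS _ (U.starProjection_apply_mem x))
  exact commute_of_mul_mul_eq (isSelfAdjoint_starProjection U) (compress h) (compress h')

theorem exists_map_eq_of_inner_eq {ι : Type*} {a b : ι → H}
    (h : ∀ i j, ⟪b i, b j⟫_𝕜 = ⟪a i, a j⟫_𝕜) :
    ∃ T : H →L[𝕜] H, (∀ i, T (a i) = b i) ∧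
      ∀ w ∈ (Submodule.span 𝕜 (Set.range a))ᗮ, T w = 0 := by
  let Φ := Finsupp.linearCombination 𝕜 a
  let Ψ := Finsupp.linearCombination 𝕜 b
  let U := (Submodule.span 𝕜 (Set.range a)).topologicalClosure
  have : CompleteSpace U := (Submodule.isClosed_topologicalClosure _).completeSpace_coe
  have hΦU : ∀ f, Φ f ∈ U := fun f => Submodule.le_topologicalClosure _ <| by
    rw [← Finsupp.range_linearCombination]
    exact LinearMap.mem_range_self Φ f
  let e : (ι →₀ 𝕜) →ₗ[𝕜] U := Φ.codRestrict U hΦU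
  have he : DenseRange e := fun x => by
    have hrange : ((↑) '' Set.range e : Set H) = Submodule.span 𝕜 (Set.range a) := by
      rw [← Finsupp.range_linearCombination, ← Set.range_comp]
      rfl
    rw [closure_subtype, hrange]
    exact x.2
  have hnorm : ∀ f, ‖Ψ f‖ = ‖e f‖ := fun f => by
    change ‖Ψ f‖ = ‖Φ f‖
    have hinner : ⟪Ψ f, Ψ f⟫_𝕜 = ⟪Φ f, Φ f⟫_𝕜 := by
      simp only [Φ, Ψ, Finsupp.linearCombination_apply, Finsupp.sum, sum_inner, inner_sum,
        inner_smul_left, inner_smul_right, h]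
    rw [@norm_eq_sqrt_re_inner 𝕜, @norm_eq_sqrt_re_inner 𝕜, hinner]
  refine ⟨Ψ.extendOfNorm e ∘L U.orthogonalProjectionOnto, fun i => ?_, fun w hw => ?_⟩
  · have hproj : U.orthogonalProjectionOnto (a i) = e (Finsupp.single i 1) := by
      have hai : a i = e (Finsupp.single i 1) := by simp [e, Φ]
      rw [hai, U.orthogonalProjectionOnto_mem_subspace_eq_self]
    rw [ContinuousLinearMap.comp_apply, hproj,
      LinearMap.extendOfNorm_eq he ⟨1, fun f => by rw [hnorm, one_mul]⟩]
    simp [Ψ]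
  · rw [← Submodule.orthogonal_closure] at hw
    rw [ContinuousLinearMap.comp_apply,
      Submodule.orthogonalProjectionOnto_apply_of_mem_orthogonal hw, map_zero]

theorem commute_of_span_range {ι : Type*} {a : ι → H} {S T : H →L[𝕜] H}
    (hT : ∀ w ∈ (Submodule.span 𝕜 (Set.range a))ᗮ, T w = 0)
    (hS : ∀ i, star S (a i) ∈ Submodule.span 𝕜 (Set.range a))
    (h : ∀ i, T (S (a i)) = S (T (a i))) : Commute T S := by
  let U := Submodule.span 𝕜 (Set.range a)
  have : CompleteSpace U.topologicalClosure := U.isClosed_topologicalClosure.completeSpace_coe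
  let E : Submodule 𝕜 H := LinearMap.eqLocus (T * S).toLinearMap (S * T).toLinearMap
  have hUE : U.topologicalClosure ≤ E :=
    U.topologicalClosure_minimal (Submodule.span_le.mpr (Set.range_subset_iff.mpr h))
      (isClosed_eq (T * S).continuous (S * T).continuous)
  have hU : ∀ u ∈ U, star S u ∈ U := fun u hu =>
    (Submodule.span_le (p := U.comap (star S).toLinearMap)).mpr (Set.range_subset_iff.mpr hS) hu
  have hUE' : U.topologicalClosureᗮ ≤ E := fun w hw => by
    rw [Submodule.orthogonal_closure] at hw
    have hSw : S w ∈ Uᗮ := fun u hu => by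
      rw [← ContinuousLinearMap.adjoint_inner_left, ← ContinuousLinearMap.star_eq_adjoint]
      exact hw _ (hU u hu)
    change T (S w) = S (T w)
    rw [hT w hw, hT _ hSw, map_zero]
  have hE : E = ⊤ := top_unique <|
    Submodule.sup_orthogonal_of_hasOrthogonalProjection.ge.trans (sup_le hUE hUE')
  exact ContinuousLinearMap.ext fun z => (hE ▸ Submodule.mem_top : z ∈ E)

theorem exists_centralizer_mul_eq_of_isometry (A : StarSubalgebra 𝕜 (H →L[𝕜] H)) {p u : H →L[𝕜] H}
    (hpA : p ∈ A) (hp : IsStarProjection p) (hu : star u * u = 1)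
    (huA : ∀ b ∈ A, Commute u (p * b * p)) :
    ∃ T ∈ Set.centralizer (A : Set (H →L[𝕜] H)), T * p = u * p ∧
      ∀ m ∈ Set.centralizer (A : Set (H →L[𝕜] H)), Commute m u → Commute T m := by
  -- `T` is the map `b p k ↦ b p u k`; it is isometric because `u` commutes with `p A p`.
  let a : A × H → H := fun i => (i.1 : H →L[𝕜] H) (p i.2)
  let a' : A × H → H := fun i => (i.1 : H →L[𝕜] H) (p (u i.2))
  have ha : ∀ i, a i ∈ Submodule.span 𝕜 (Set.range a) := fun i =>
    Submodule.subset_span (Set.mem_range_self i)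
  have hgram : ∀ (b c : A) (k l : H), ⟪(b : H →L[𝕜] H) (p k), (c : H →L[𝕜] H) (p l)⟫_𝕜 =
      ⟪k, (p * (star b * c : A) * p) l⟫_𝕜 := fun b c k l => by
    rw [← mul_apply_eq_comp, ← mul_apply_eq_comp, inner_apply_apply, star_mul,
      hp.isSelfAdjoint.star_eq]
    simp only [MulMemClass.coe_mul, StarMemClass.coe_star, mul_assoc]
  obtain ⟨T, hTa, hT⟩ := exists_map_eq_of_inner_eq (𝕜 := 𝕜) (a := a) (b := a') fun i j => by
    rw [hgram, hgram, ← apply_comm_of_commute (huA _ (star i.1 * j.1).2), inner_apply_apply, hu,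
      one_apply_eq_self]
  have hup : Commute u p := by
    simpa only [mul_one, hp.isIdempotentElem.eq] using huA 1 (one_mem A)
  have hma : ∀ m ∈ Set.centralizer (A : Set (H →L[𝕜] H)), ∀ i : A × H,
      m (a i) = a (i.1, m i.2) := fun m hm i => by
    rw [← apply_comm_of_commute (hm _ i.1.2), ← apply_comm_of_commute (hm _ hpA)]
  have hba : ∀ (b : A) (i : A × H), (b : H →L[𝕜] H) (a i) = a (b * i.1, i.2) := fun _ _ => rfl
  have hba' : ∀ (b : A) (i : A × H), (b : H →L[𝕜] H) (a' i) = a' (b * i.1, i.2) := fun _ _ => rfl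
  have hTA : ∀ b : A, Commute T b := fun b => commute_of_span_range hT
    (fun i => by rw [← StarMemClass.coe_star, hba]; exact ha _)
    fun i => by rw [hba, hTa, hTa, hba']
  refine ⟨T, fun b hb => (hTA ⟨b, hb⟩).eq.symm, ?_,
    fun m hm hmu => commute_of_span_range hT (fun i => ?_) fun i => ?_⟩
  · refine ContinuousLinearMap.ext fun k => (hTa (1, k)).trans ?_
    exact (apply_comm_of_commute hup k).symm
  · rw [hma _ (Set.star_mem_centralizer' (fun _ => star_mem) hm)]
    exact ha _
  · rw [hma m hm, hTa, hTa, ← apply_comm_of_commute (hm _ i.1.2),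
      ← apply_comm_of_commute (hm _ hpA), apply_comm_of_commute hmu]

end Operators

section WeakLimits

open Filter Topology

variable {𝕜 H : Type*} [RCLike 𝕜] [NormedAddCommGroup H] [InnerProductSpace 𝕜 H] [CompleteSpace H]

theorem exists_tendsto_inner_of_norm_le {ι : Type*} (F : Ultrafilter ι) {g : ι → H →L[𝕜] H}
    {r : ℝ} (hg : ∀ i, ‖g i‖ ≤ r) :
    ∃ T : H →L[𝕜] H, ‖T‖ ≤ r ∧
      ∀ v w, Tendsto (fun i => ⟪g i v, w⟫_𝕜) F (𝓝 ⟪T v, w⟫_𝕜) := by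
  have hbound : ∀ i v w, ‖⟪g i v, w⟫_𝕜‖ ≤ r * ‖v‖ * ‖w‖ := fun i v w =>
    (norm_inner_le_norm _ _).trans (by gcongr; exact (g i).le_of_opNorm_le (hg i) v)
  have hr : 0 ≤ r := (norm_nonneg _).trans (hg (F.nonempty_of_mem univ_mem).some)
  have hlim : ∀ v w, ∃ z, Tendsto (fun i => ⟪g i v, w⟫_𝕜) F (𝓝 z) := fun v w => by
    obtain ⟨z, -, hz⟩ := (isCompact_closedBall (0 : 𝕜) (r * ‖v‖ * ‖w‖)).ultrafilter_le_nhds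
      (F.map fun i => ⟪g i v, w⟫_𝕜)
      (tendsto_principal.mpr (Eventually.of_forall fun i =>
        mem_closedBall_zero_iff.mpr (hbound i v w)))
    exact ⟨z, hz⟩
  choose β hβ using hlim
  let form : H →ₗ⋆[𝕜] H →ₗ[𝕜] 𝕜 := LinearMap.mk₂'ₛₗ (starRingEnd 𝕜) (RingHom.id 𝕜) β
    (fun v v' w => tendsto_nhds_unique (hβ _ _) (by
      simpa only [map_add, inner_add_left] using (hβ v w).add (hβ v' w)))
    (fun c v w => tendsto_nhds_unique (hβ _ _) (by
      simpa only [map_smul, inner_smul_left, smul_eq_mul]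
        using (hβ v w).const_mul (starRingEnd 𝕜 c)))
    (fun v w w' => tendsto_nhds_unique (hβ _ _) (by
      simpa only [inner_add_right] using (hβ v w).add (hβ v w')))
    (fun c v w => tendsto_nhds_unique (hβ _ _) (by
      simpa only [inner_smul_right, smul_eq_mul, RingHom.id_apply] using (hβ v w).const_mul c))
  have hform : ∀ v w, ‖form v w‖ ≤ r * ‖v‖ * ‖w‖ := fun v w =>
    le_of_tendsto (hβ v w).norm (Eventually.of_forall fun i => hbound i v w)
  let T := InnerProductSpace.continuousLinearMapOfBilin (form.mkContinuous₂ r hform)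
  have hT : ∀ v w, ⟪T v, w⟫_𝕜 = form v w := fun v w =>
    InnerProductSpace.continuousLinearMapOfBilin_apply _ v w
  refine ⟨T, T.opNorm_le_of_re_inner_le hr fun v w hv hw => ?_,
    fun v w => by rw [hT]; exact hβ v w⟩
  simpa only [hT, hv, hw, mul_one] using (RCLike.re_le_norm _).trans (hform v w)

end WeakLimits

theorem exists_mem_forall_fixed {E : Type*} [NormedAddCommGroup E] [InnerProductSpace ℝ E]
    [CompleteSpace E] {C : Set E} (hne : C.Nonempty) (hcl : IsClosed C) (hconv : Convex ℝ C) :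
    ∃ c ∈ C, ∀ g : E → E, Set.MapsTo g C C → (∀ z ∈ C, ‖g z‖ ≤ ‖z‖) → g c = c := by
  obtain ⟨c, hc, hmin⟩ := exists_norm_eq_iInf_of_complete_convex hne hcl.isComplete hconv 0
  refine ⟨c, hc, fun g hgC hg => ?_⟩
  have hinner := (norm_eq_iInf_iff_real_inner_le_zero hconv hc).mp hmin (g c) (hgC hc)
  have hexpand := norm_sub_sq_real (g c) c
  rw [zero_sub, inner_neg_left, inner_sub_right, real_inner_self_eq_norm_sq,
    real_inner_comm] at hinner
  have hnorm := pow_le_pow_left₀ (norm_nonneg _) (hg c hc) 2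
  have hzero : ‖g c - c‖ ^ 2 ≤ 0 := by linarith
  exact sub_eq_zero.mp (norm_eq_zero.mp (pow_eq_zero_iff two_ne_zero |>.mp
    (hzero.antisymm (sq_nonneg _))))

theorem span_inter_unitary {A : Type*} [CStarAlgebra A] (S : StarSubalgebra ℂ A)
    [IsClosed (S : Set A)] :
    Submodule.span ℂ ((S : Set A) ∩ unitary A) = S.toSubalgebra.toSubmodule := by
  have himage : (S : Set A) ∩ unitary A = S.subtype.toLinearMap '' (unitary S : Set S) := by
    ext u
    constructor
    · rintro ⟨huS, hu⟩
      exact ⟨⟨u, huS⟩, ⟨Subtype.ext hu.1, Subtype.ext hu.2⟩, rfl⟩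
    · rintro ⟨u, hu, rfl⟩
      exact ⟨u.2, congrArg Subtype.val hu.1, congrArg Subtype.val hu.2⟩
  rw [himage, Submodule.span_image, CStarAlgebra.span_unitary, Submodule.map_top]
  ext x
  simp

theorem centralizer_inter_unitary {A : Type*} [CStarAlgebra A] (S : StarSubalgebra ℂ A)
    [IsClosed (S : Set A)] :
    ((S : Set A) ∩ unitary A).centralizer = (S : Set A).centralizer := by
  refine (Set.centralizer_subset Set.inter_subset_left).antisymm' fun y hy => ?_
  have hS : S.toSubalgebra.toSubmodule ≤ (Subalgebra.centralizer ℂ {y}).toSubmodule := by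
    rw [← span_inter_unitary, Submodule.span_le]
    rintro u hu _ rfl
    exact (hy u hu).symm
  exact fun b hb => (hS hb y rfl).symm

section VonNeumann

variable {H : Type*} [NormedAddCommGroup H] [InnerProductSpace ℂ H] [CompleteSpace H]
variable (P : VonNeumannAlgebra H)

variable {P} in
theorem mem_of_forall_commute {x : H →L[ℂ] H} (h : ∀ m, (∀ y ∈ P, Commute y m) → Commute x m) :
    x ∈ P := by
  rw [← VonNeumannAlgebra.commutant_commutant P, VonNeumannAlgebra.mem_commutant_iff]
  exact fun m hm => (h m (VonNeumannAlgebra.mem_commutant_iff.mp hm)).eq.symm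

open Filter Topology in
theorem mem_of_tendsto_inner {ι : Type*} {l : Filter ι} [l.NeBot] {g : ι → H →L[ℂ] H}
    {T : H →L[ℂ] H} (hg : ∀ i, g i ∈ P)
    (hT : ∀ v w, Tendsto (fun i => ⟪g i v, w⟫_ℂ) l (𝓝 ⟪T v, w⟫_ℂ)) : T ∈ P := by
  refine mem_of_forall_commute fun m hm => ContinuousLinearMap.ext fun v =>
    ext_inner_right ℂ fun w => tendsto_nhds_unique (hT (m v) w) ?_
  rw [mul_apply_eq_comp, ← ContinuousLinearMap.adjoint_inner_right]
  refine (hT v _).congr fun i => ?_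
  rw [ContinuousLinearMap.adjoint_inner_right, apply_comm_of_commute (hm _ (hg i))]

theorem exists_mem_centralizer_mul_eq {A : StarSubalgebra ℂ (H →L[ℂ] H)} (hAP : ∀ b ∈ A, b ∈ P)
    {p y : H →L[ℂ] H} (hpA : p ∈ A) (hp : IsStarProjection p) (hyP : y ∈ P)
    (hyA : ∀ b ∈ A, Commute y (p * b * p)) :
    ∃ x ∈ Set.centralizer (A : Set (H →L[ℂ] H)) ∩ P, x * p = y * p := by
  let corner : Set (H →L[ℂ] H) := {c | ∃ b ∈ A, p * b * p = c}
  let S := P.toStarSubalgebra ⊓ StarSubalgebra.centralizer ℂ corner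
  have : IsClosed (S : Set (H →L[ℂ] H)) :=
    (isClosed_coe P).inter (Set.isClosed_centralizer _)
  let X := Subalgebra.centralizer ℂ (A : Set (H →L[ℂ] H)) ⊓ P.toStarSubalgebra.toSubalgebra
  let V := (X.toSubmodule.map (LinearMap.mulRight ℂ p)).comap (LinearMap.mulRight ℂ p)
  have hSV : S.toSubalgebra.toSubmodule ≤ V := by
    rw [← span_inter_unitary, Submodule.span_le]
    rintro u ⟨⟨huP, hucorner⟩, hu⟩
    have huA : ∀ b ∈ A, Commute u (p * b * p) := fun b hb =>
      ((StarSubalgebra.mem_centralizer_iff ℂ).mp hucorner _ ⟨b, hb, rfl⟩).1.symm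
    obtain ⟨T, hTA, hTp, hT⟩ := exists_centralizer_mul_eq_of_isometry A hpA hp hu.1 huA
    exact ⟨T, ⟨hTA, mem_of_forall_commute fun m hm =>
      hT m (fun b hb => hm b (hAP b hb)) (hm u huP).symm⟩, hTp⟩
  have hyS : y ∈ S := by
    refine ⟨hyP, (StarSubalgebra.mem_centralizer_iff ℂ).mpr ?_⟩
    rintro _ ⟨b, hb, rfl⟩
    refine ⟨(hyA b hb).eq.symm, ?_⟩
    rw [star_mul, star_mul, hp.isSelfAdjoint.star_eq, ← mul_assoc]
    exact (hyA _ (star_mem hb)).eq.symm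
  exact hSV hyS

end VonNeumann

section Generated

variable {K : Type*} [NormedAddCommGroup K] [InnerProductSpace ℂ K] [CompleteSpace K]
variable {s : Set (K →L[ℂ] K)} {x : K →L[ℂ] K}

theorem mem_generated_of_mem (hx : x ∈ s) : x ∈ generated s :=
  (StarSubalgebra.mem_centralizer_iff ℂ).mpr fun _ hm =>
    ⟨((StarSubalgebra.mem_centralizer_iff ℂ).mp hm x hx).1.symm,
      ((StarSubalgebra.mem_centralizer_iff ℂ).mp (star_mem hm) x hx).1.symm⟩

theorem commute_of_mem_generated (hx : x ∈ generated s) {m : K →L[ℂ] K}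
    (hm : ∀ g ∈ s, Commute g m ∧ Commute (star g) m) : Commute x m := by
  have hms : m ∈ StarSubalgebra.centralizer ℂ s := (StarSubalgebra.mem_centralizer_iff ℂ).mpr hm
  exact ((StarSubalgebra.mem_centralizer_iff ℂ).mp hx m hms).1.symm

end Generated

section L2

variable {K : Type*} [NormedAddCommGroup K] [InnerProductSpace ℂ K] [CompleteSpace K]
variable {M : VonNeumannAlgebra K} (τ : FaithfulNormalTrace M)

theorem inner_toL2 (x y : Elem M) : ⟪toL2 τ x, toL2 τ y⟫_ℂ = τ.toLinearMap (star x * y) :=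
  UniformSpace.Completion.inner_coe (𝕜 := ℂ) (E := τ.toPositive.PreGNS) _ _

theorem denseRange_toL2 : DenseRange (toL2 τ) :=
  UniformSpace.Completion.denseRange_coe (α := τ.toPositive.PreGNS)

theorem lmul_toL2 (x y : Elem M) : lmul τ x (toL2 τ y) = toL2 τ (x * y) :=
  τ.toPositive.gnsNonUnitalStarAlgHom_apply_coe

theorem toL2_injective : Function.Injective (toL2 τ) := by
  refine (injective_iff_map_eq_zero _).mpr fun x hx => τ.faithful x ?_
  rw [← inner_toL2, hx, inner_zero_left]

theorem norm_toL2_star (x : Elem M) : ‖toL2 τ (star x)‖ = ‖toL2 τ x‖ := by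
  rw [@norm_eq_sqrt_re_inner ℂ, @norm_eq_sqrt_re_inner ℂ, inner_toL2, inner_toL2, star_star,
    τ.tracial]

theorem norm_toL2_mul_le (x y : Elem M) : ‖toL2 τ (x * y)‖ ≤ ‖lmul τ (star y)‖ * ‖toL2 τ x‖ := by
  rw [← norm_toL2_star τ (x * y), star_mul, ← lmul_toL2, ← norm_toL2_star τ x]
  exact (lmul τ (star y)).le_opNorm _

/-- Right multiplication by `y ∈ M` on `L²(M, τ)`, extended by continuity from `M ξ`; it is
bounded because `τ` is a trace. -/
def rmul (y : Elem M) : L2 τ →L[ℂ] L2 τ :=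
  (toL2 τ ∘ₗ LinearMap.mulRight ℂ y).extendOfNorm (toL2 τ)

theorem rmul_toL2 (y x : Elem M) : rmul τ y (toL2 τ x) = toL2 τ (x * y) :=
  LinearMap.extendOfNorm_eq (denseRange_toL2 τ)
    ⟨‖lmul τ (star y)‖, fun x => norm_toL2_mul_le τ x y⟩ x

variable {τ} in
theorem ext_toL2 {S T : L2 τ →L[ℂ] L2 τ} (h : ∀ x, S (toL2 τ x) = T (toL2 τ x)) : S = T :=
  DFunLike.coe_injective
    ((denseRange_toL2 τ).equalizer S.continuous T.continuous (funext h))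

theorem rmul_mul (x y : Elem M) : rmul τ (x * y) = rmul τ y * rmul τ x :=
  ext_toL2 fun z => by simp only [mul_apply_eq_comp, rmul_toL2, mul_assoc]

theorem lmul_rmul_commute (x y : Elem M) : Commute (lmul τ x) (rmul τ y) :=
  ext_toL2 fun z => by simp only [mul_apply_eq_comp, rmul_toL2, lmul_toL2, mul_assoc]

theorem star_rmul (y : Elem M) : star (rmul τ y) = rmul τ (star y) := by
  refine ext_toL2 fun x => (denseRange_toL2 τ).eq_of_inner_left ℂ fun z => ?_
  rw [ContinuousLinearMap.star_eq_adjoint, ContinuousLinearMap.adjoint_inner_left, rmul_toL2,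
    rmul_toL2, inner_toL2, inner_toL2, star_mul, star_star, ← mul_assoc, τ.tracial, mul_assoc]

end L2

section Jones

variable {K : Type*} [NormedAddCommGroup K] [InnerProductSpace ℂ K] [CompleteSpace K]
variable {M : VonNeumannAlgebra K} (τ : FaithfulNormalTrace M) {B : VonNeumannAlgebra K}

theorem toL2_mem_L2Sub {b : Elem M} (hb : (b : K →L[ℂ] K) ∈ B) : toL2 τ b ∈ L2Sub τ B :=
  Submodule.le_topologicalClosure _ (Submodule.subset_span ⟨b, hb, rfl⟩)

theorem L2Sub_le {V : Submodule ℂ (L2 τ)} (hV : IsClosed (V : Set (L2 τ)))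
    (h : ∀ b : Elem M, (b : K →L[ℂ] K) ∈ B → toL2 τ b ∈ V) : L2Sub τ B ≤ V :=
  Submodule.topologicalClosure_minimal _
    (Submodule.span_le.mpr (by rintro _ ⟨b, hb, rfl⟩; exact h b hb)) hV

theorem isClosed_L2Sub : IsClosed (L2Sub τ B : Set (L2 τ)) :=
  Submodule.isClosed_topologicalClosure _

theorem map_mem_L2Sub (T : L2 τ →L[ℂ] L2 τ)
    (h : ∀ b : Elem M, (b : K →L[ℂ] K) ∈ B → T (toL2 τ b) ∈ L2Sub τ B) :
    ∀ x ∈ L2Sub τ B, T x ∈ L2Sub τ B :=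
  L2Sub_le τ (V := (L2Sub τ B).comap T.toLinearMap) ((isClosed_L2Sub τ).preimage T.continuous) h

theorem lmul_mem_L2Sub {b : Elem M} (hb : (b : K →L[ℂ] K) ∈ B) :
    ∀ x ∈ L2Sub τ B, lmul τ b x ∈ L2Sub τ B :=
  map_mem_L2Sub τ _ fun c hc => by
    rw [lmul_toL2]
    exact toL2_mem_L2Sub τ (mul_mem hb hc)

theorem rmul_mem_L2Sub {b : Elem M} (hb : (b : K →L[ℂ] K) ∈ B) :
    ∀ x ∈ L2Sub τ B, rmul τ b x ∈ L2Sub τ B :=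
  map_mem_L2Sub τ _ fun c hc => by
    rw [rmul_toL2]
    exact toL2_mem_L2Sub τ (mul_mem hc hb)

theorem isStarProjection_jones : IsStarProjection (jones τ B) :=
  isStarProjection_starProjection

theorem jones_lmul_commute {b : Elem M} (hb : (b : K →L[ℂ] K) ∈ B) :
    Commute (jones τ B) (lmul τ b) :=
  commute_starProjection (lmul_mem_L2Sub τ hb) (by
    rw [← map_star]
    exact lmul_mem_L2Sub τ (b := star b) (star_mem (S := VonNeumannAlgebra K) hb))

theorem jones_rmul_commute {b : Elem M} (hb : (b : K →L[ℂ] K) ∈ B) :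
    Commute (jones τ B) (rmul τ b) :=
  commute_starProjection (rmul_mem_L2Sub τ hb) (by
    rw [star_rmul]
    exact rmul_mem_L2Sub τ (b := star b) (star_mem (S := VonNeumannAlgebra K) hb))

theorem lmul_mem_basic (a : Elem M) : lmul τ a ∈ basic τ B :=
  mem_generated_of_mem (Or.inl ⟨a, rfl⟩)

theorem jones_mem_basic : jones τ B ∈ basic τ B :=
  mem_generated_of_mem (Or.inr rfl)

variable {τ}

theorem commute_rmul_of_mem_basic {x : L2 τ →L[ℂ] L2 τ} (hx : x ∈ basic τ B) {b : Elem M}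
    (hb : (b : K →L[ℂ] K) ∈ B) : Commute x (rmul τ b) := by
  refine commute_of_mem_generated hx ?_
  rintro _ (⟨a, rfl⟩ | rfl)
  · rw [← map_star]
    exact ⟨lmul_rmul_commute τ a b, lmul_rmul_commute τ (star a) b⟩
  · rw [(isStarProjection_jones τ).isSelfAdjoint.star_eq]
    exact ⟨jones_rmul_commute τ hb, jones_rmul_commute τ hb⟩

theorem map_toL2_mul_of_mem_basic {x : L2 τ →L[ℂ] L2 τ} (hx : x ∈ basic τ B) (a : Elem M)
    {b : Elem M} (hb : (b : K →L[ℂ] K) ∈ B) : x (toL2 τ (a * b)) = rmul τ b (x (toL2 τ a)) := by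
  rw [← rmul_toL2, apply_comm_of_commute (commute_rmul_of_mem_basic hx hb)]

theorem map_toL2_mul_of_mem_relComm {x : L2 τ →L[ℂ] L2 τ} (hx : x ∈ relComm τ B) {b : Elem M}
    (hb : (b : K →L[ℂ] K) ∈ B) (a : Elem M) : x (toL2 τ (b * a)) = lmul τ b (x (toL2 τ a)) := by
  rw [← lmul_toL2, ← apply_comm_of_commute (hx.1 _ ⟨b, hb, rfl⟩)]

theorem star_mem_relComm {x : L2 τ →L[ℂ] L2 τ} (hx : x ∈ relComm τ B) : star x ∈ relComm τ B := by
  refine ⟨Set.star_mem_centralizer' ?_ hx.1, star_mem (S := VonNeumannAlgebra (L2 τ)) hx.2⟩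
  rintro _ ⟨b, hb, rfl⟩
  exact ⟨star b, star_mem (S := VonNeumannAlgebra K) hb, map_star _ b⟩

end Jones

section Normality

open Filter Topology

variable {K : Type*} [NormedAddCommGroup K] [InnerProductSpace ℂ K] [CompleteSpace K]
variable {M : VonNeumannAlgebra K} (τ : FaithfulNormalTrace M)

variable {τ} in
theorem tendsto_trace_mul {ι : Type*} {F : Filter ι} {g : ι → Elem M} {T : Elem M} {r : ℝ}
    (hg : ∀ i, ‖g i‖ ≤ r)
    (h : ∀ v w, Tendsto (fun i => ⟪(g i : K →L[ℂ] K) v, w⟫_ℂ) F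
      (𝓝 ⟪(T : K →L[ℂ] K) v, w⟫_ℂ)) (a : Elem M) :
    Tendsto (fun i => τ.toLinearMap (a * g i)) F (𝓝 (τ.toLinearMap (a * T))) := by
  obtain ⟨ζ, η, hζ, hη, hsum⟩ := τ.normal
  have htrace : ∀ x : Elem M, τ.toLinearMap (a * x) =
      ∑' i, ⟪star (a : K →L[ℂ] K) (ζ i), (x : K →L[ℂ] K) (η i)⟫_ℂ := fun x => by
    rw [← (hsum (a * x)).tsum_eq]
    refine tsum_congr fun i => ?_
    rw [ContinuousLinearMap.star_eq_adjoint, ContinuousLinearMap.adjoint_inner_left]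
    rfl
  have hsummable : Summable fun i => ‖ζ i‖ * ‖η i‖ :=
    .of_nonneg_of_le (fun i => by positivity)
      (fun i => by nlinarith [sq_nonneg (‖ζ i‖ - ‖η i‖), sq_nonneg ‖ζ i‖, sq_nonneg ‖η i‖])
      (hζ.add hη)
  simp only [htrace]
  refine tendsto_tsum_of_dominated_convergence
    (bound := fun i => ‖star (a : K →L[ℂ] K)‖ * r * (‖ζ i‖ * ‖η i‖)) (hsummable.mul_left _)
    (fun i => ?_) (Eventually.of_forall fun j i => ?_)
  · have hconj := (Complex.continuous_conj.tendsto _).comp (h (η i) (star (a : K →L[ℂ] K) (ζ i)))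
    simpa only [Function.comp_def, inner_conj_symm] using hconj
  · calc _ ≤ ‖star (a : K →L[ℂ] K) (ζ i)‖ * ‖(g j : K →L[ℂ] K) (η i)‖ := norm_inner_le_norm _ _
      _ ≤ (‖star (a : K →L[ℂ] K)‖ * ‖ζ i‖) * (r * ‖η i‖) := by
        gcongr
        · exact ContinuousLinearMap.le_opNorm _ _
        · exact ContinuousLinearMap.le_of_opNorm_le _ (hg j) _
      _ = _ := by ring

theorem isClosed_toL2_image_closedBall (r : ℝ) :
    IsClosed (toL2 τ '' Metric.closedBall 0 r) := by
  refine IsSeqClosed.isClosed fun η ζ hη hζ => ?_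
  choose g hgr hg using hη
  have hgr : ∀ n, ‖g n‖ ≤ r := fun n => mem_closedBall_zero_iff.mp (hgr n)
  obtain ⟨T, hTr, hT⟩ := exists_tendsto_inner_of_norm_le (hyperfilter ℕ)
    (g := fun n => (g n : K →L[ℂ] K)) hgr
  let z : Elem M := ⟨T, mem_of_tendsto_inner M (fun n => (g n).2) hT⟩
  refine ⟨z, mem_closedBall_zero_iff.mpr hTr, (denseRange_toL2 τ).eq_of_inner_right ℂ fun a => ?_⟩
  have hlim : Tendsto (fun n => ⟪toL2 τ a, η n⟫_ℂ) (hyperfilter ℕ) (𝓝 ⟪toL2 τ a, ζ⟫_ℂ) :=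
    (tendsto_const_nhds.inner hζ).mono_left Nat.hyperfilter_le_atTop
  refine tendsto_nhds_unique ?_ hlim
  simpa only [← hg, inner_toL2] using tendsto_trace_mul (T := z) hgr hT (star a)

theorem convex_toL2_image_closedBall (r : ℝ) :
    Convex ℝ (toL2 τ '' Metric.closedBall 0 r) :=
  (convex_closedBall (0 : Elem M) r).linear_image ((toL2 τ).restrictScalars ℝ)

end Normality

section CentralVectors

variable {K : Type*} [NormedAddCommGroup K] [InnerProductSpace ℂ K] [CompleteSpace K]
variable {M : VonNeumannAlgebra K} (τ : FaithfulNormalTrace M) (S : Set (Elem M))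

/-- The vectors `ω ∈ L²(M, τ)` that commute with `S ⊆ M`, that is, `b ω = ω b` for all `b ∈ S`. -/
def centralVectors : Submodule ℂ (L2 τ) :=
  ⨅ b ∈ S, LinearMap.eqLocus (lmul τ b).toLinearMap (rmul τ b).toLinearMap

variable {S} in
theorem mem_centralVectors {ω : L2 τ} :
    ω ∈ centralVectors τ S ↔ ∀ b ∈ S, lmul τ b ω = rmul τ b ω := by
  simp only [centralVectors, Submodule.mem_iInf, LinearMap.mem_eqLocus, ContinuousLinearMap.coe_coe]

instance : CompleteSpace (centralVectors τ S) := by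
  have hcl : IsClosed (centralVectors τ S : Set (L2 τ)) := by
    simp only [centralVectors, Submodule.coe_iInf]
    exact isClosed_biInter fun b _ => isClosed_eq (lmul τ b).continuous (rmul τ b).continuous
  exact hcl.completeSpace_coe

variable {S}

theorem toL2_mem_centralVectors {y : Elem M} (hy : y ∈ S.centralizer) :
    toL2 τ y ∈ centralVectors τ S :=
  (mem_centralVectors τ).mpr fun b hb => by rw [lmul_toL2, rmul_toL2, hy b hb]

theorem norm_lmul_rmul_star_apply {u : Elem M} (hu : u ∈ unitary (Elem M)) (z : L2 τ) :
    ‖lmul τ u (rmul τ (star u) z)‖ = ‖z‖ := by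
  refine (denseRange_toL2 τ).induction_on z (isClosed_eq (by fun_prop) continuous_norm) fun a => ?_
  rw [rmul_toL2, lmul_toL2, @norm_eq_sqrt_re_inner ℂ, @norm_eq_sqrt_re_inner ℂ, inner_toL2,
    inner_toL2]
  have hconj : star (u * (a * star u)) * (u * (a * star u)) = u * (star a * a * star u) := by
    calc _ = u * star a * (star u * u) * a * star u := by
          simp only [star_mul, star_star, mul_assoc]
      _ = _ := by rw [hu.1]; simp only [mul_one, mul_assoc]
  rw [hconj, τ.tracial, mul_assoc, hu.1, mul_one]

theorem inner_lmul_rmul_star_apply {ω : L2 τ} (hω : ω ∈ centralVectors τ S) {u : Elem M}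
    (huS : u ∈ S) (hu : u ∈ unitary (Elem M)) (z : L2 τ) :
    ⟪ω, lmul τ u (rmul τ (star u) z)⟫_ℂ = ⟪ω, z⟫_ℂ := by
  have hfixed : rmul τ u (lmul τ (star u) ω) = ω := by
    rw [← apply_comm_of_commute (lmul_rmul_commute τ _ _), ← (mem_centralVectors τ).mp hω u huS,
      ← mul_apply_eq_comp, ← map_mul, hu.1, map_one, one_apply_eq_self]
  rw [← ContinuousLinearMap.adjoint_inner_left, ← ContinuousLinearMap.adjoint_inner_left,
    ← ContinuousLinearMap.star_eq_adjoint, ← ContinuousLinearMap.star_eq_adjoint, ← map_star,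
    star_rmul, star_star, hfixed]

theorem mapsTo_lmul_rmul_star_toL2_image_closedBall {u : Elem M} (hu : u ∈ unitary (Elem M))
    (r : ℝ) : Set.MapsTo (fun z => lmul τ u (rmul τ (star u) z))
      (toL2 τ '' Metric.closedBall 0 r) (toL2 τ '' Metric.closedBall 0 r) := by
  rintro _ ⟨z, hz, rfl⟩
  refine ⟨u * (z * star u), ?_, by simp only [rmul_toL2, lmul_toL2]⟩
  rwa [mem_closedBall_zero_iff, CStarRing.norm_mem_unitary_mul _ hu,
    CStarRing.norm_mul_mem_unitary _ (Unitary.star_mem hu), ← mem_closedBall_zero_iff]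

theorem exists_mem_centralizer_inner_eq (hS : S ⊆ unitary (Elem M)) (x : Elem M) :
    ∃ y ∈ S.centralizer, ∀ ω ∈ centralVectors τ S, ⟪ω, toL2 τ y⟫_ℂ = ⟪ω, toL2 τ x⟫_ℂ := by
  let : InnerProductSpace ℝ (L2 τ) := .rclikeToReal ℂ (L2 τ)
  let ball := toL2 τ '' Metric.closedBall 0 ‖x‖
  let slice := ⋂ ω ∈ centralVectors τ S, {η | ⟪ω, η⟫_ℂ = ⟪ω, toL2 τ x⟫_ℂ}
  have mem_slice : ∀ {η}, η ∈ slice ↔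
      ∀ ω ∈ centralVectors τ S, ⟪ω, η⟫_ℂ = ⟪ω, toL2 τ x⟫_ℂ := Set.mem_iInter₂
  have hslice_closed : IsClosed slice := isClosed_biInter fun ω _ =>
    isClosed_eq (by fun_prop) continuous_const
  have hslice_convex : Convex ℝ slice := convex_iInter₂ fun ω _ =>
    (convex_singleton ⟪ω, toL2 τ x⟫_ℂ).linear_preimage
      ((innerSL ℂ ω).toLinearMap.restrictScalars ℝ)
  obtain ⟨_, ⟨⟨y, -, rfl⟩, hyslice⟩, hfixed⟩ := exists_mem_forall_fixed
    (C := ball ∩ slice)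
    ⟨toL2 τ x, ⟨x, mem_closedBall_zero_iff.mpr le_rfl, rfl⟩, mem_slice.mpr fun _ _ => rfl⟩
    ((isClosed_toL2_image_closedBall τ ‖x‖).inter hslice_closed)
    ((convex_toL2_image_closedBall τ ‖x‖).inter hslice_convex)
  refine ⟨y, fun u hu => ?_, mem_slice.mp hyslice⟩
  have hyu := hfixed (fun z => lmul τ u (rmul τ (star u) z))
    ((mapsTo_lmul_rmul_star_toL2_image_closedBall τ (hS hu) ‖x‖).inter_inter
      fun z hz => mem_slice.mpr fun ω hω =>
        (inner_lmul_rmul_star_apply τ hω hu (hS hu) z).trans (mem_slice.mp hz ω hω))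
    fun z _ => (norm_lmul_rmul_star_apply τ (hS hu) z).le
  rw [rmul_toL2, lmul_toL2] at hyu
  calc u * y = u * (y * star u) * u := by
        rw [mul_assoc, mul_assoc, (hS hu).1, mul_one]
    _ = y * u := by rw [toL2_injective τ hyu]

theorem exists_starProjection_centralVectors_eq (hS : S ⊆ unitary (Elem M)) (x : Elem M) :
    ∃ y ∈ S.centralizer, (centralVectors τ S).starProjection (toL2 τ x) = toL2 τ y := by
  obtain ⟨y, hy, hinner⟩ := exists_mem_centralizer_inner_eq τ hS x
  refine ⟨y, hy, Submodule.eq_starProjection_of_mem_orthogonal (toL2_mem_centralVectors τ hy)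
    fun ω hω => ?_⟩
  rw [inner_sub_right, hinner ω hω, sub_self]

theorem centralVectors_subset_closure (hS : S ⊆ unitary (Elem M)) :
    (centralVectors τ S : Set (L2 τ)) ⊆ closure (toL2 τ '' S.centralizer) := by
  intro ω hω
  rw [← Submodule.starProjection_eq_self_iff.mpr hω]
  refine (denseRange_toL2 τ).induction_on ω
    (isClosed_closure.preimage (ContinuousLinearMap.continuous _)) fun x => subset_closure ?_
  obtain ⟨y, hy, hxy⟩ := exists_starProjection_centralVectors_eq τ hS x
  exact ⟨y, hy, hxy.symm⟩

end CentralVectors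

section Corner

variable {K : Type*} [NormedAddCommGroup K] [InnerProductSpace ℂ K] [CompleteSpace K]
variable {M B : VonNeumannAlgebra K} (hBM : B ≤ M)
  (hB : Set.centralizer (B : Set (K →L[ℂ] K)) ∩ (M : Set (K →L[ℂ] K)) ⊆ (B : Set (K →L[ℂ] K)))

include hBM hB

theorem mul_mem_of_commute_corner {p y : K →L[ℂ] K} (hpB : p ∈ B) (hp : IsStarProjection p)
    (hyM : y ∈ M) (hy : ∀ b ∈ B, Commute y (p * b * p)) : y * p ∈ B := by
  obtain ⟨x, hx, hxp⟩ :=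
    exists_mem_centralizer_mul_eq M (A := B.toStarSubalgebra) (fun _ hb => hBM hb) hpB hp hyM hy
  exact hxp ▸ mul_mem (hB hx) hpB

theorem mem_L2Sub_of_commute_corner {τ : FaithfulNormalTrace M} {p : Elem M}
    (hpB : (p : K →L[ℂ] K) ∈ B) (hp : IsStarProjection p) {ω : L2 τ} (hpω : lmul τ p ω = ω)
    (hω : ∀ b : Elem M, (b : K →L[ℂ] K) ∈ B → Commute b p → lmul τ b ω = rmul τ b ω) :
    ω ∈ L2Sub τ B := by
  let N : StarSubalgebra ℂ (Elem M) :=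
    B.toStarSubalgebra.comap M.toStarSubalgebra.subtype ⊓ StarSubalgebra.centralizer ℂ {p}
  have mem_N : ∀ {b : Elem M}, (b : K →L[ℂ] K) ∈ B → Commute b p → b ∈ N := fun hb hbp =>
    ⟨hb, (StarSubalgebra.mem_centralizer_iff ℂ).mpr (by
      rintro _ rfl
      exact ⟨hbp.eq.symm, hp.isSelfAdjoint.star_eq.symm ▸ hbp.eq.symm⟩)⟩
  have : IsClosed (N : Set (Elem M)) :=
    ((isClosed_coe B).preimage continuous_subtype_val).inter (Set.isClosed_centralizer _)
  have hωN : ω ∈ closure (toL2 τ '' (N : Set (Elem M)).centralizer) := by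
    rw [← centralizer_inter_unitary N]
    refine centralVectors_subset_closure τ Set.inter_subset_right
      ((mem_centralVectors τ).mpr fun b hb => hω b hb.1.1 ?_)
    exact ((StarSubalgebra.mem_centralizer_iff ℂ).mp hb.1.2 p rfl).1.symm
  have hcorner : toL2 τ '' (N : Set (Elem M)).centralizer ⊆ lmul τ p ⁻¹' L2Sub τ B := by
    rintro _ ⟨y, hy, rfl⟩
    have hpy : p * y = y * p := hy p (mem_N hpB (.refl p))
    rw [Set.mem_preimage, lmul_toL2, hpy]
    refine toL2_mem_L2Sub τ (mul_mem_of_commute_corner hBM hB hpB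
      (hp.map M.toStarSubalgebra.subtype) y.2 fun b hb => ?_)
    let c : Elem M := p * ⟨b, hBM hb⟩ * p
    have hcp : Commute c p := by
      change p * _ * p * p = p * (p * _ * p)
      rw [mul_assoc _ p p, hp.isIdempotentElem.eq, ← mul_assoc, ← mul_assoc,
        hp.isIdempotentElem.eq]
    exact congrArg Subtype.val (hy c (mem_N (mul_mem (mul_mem hpB hb) hpB) hcp)).symm
  rw [← hpω]
  exact closure_minimal hcorner ((isClosed_L2Sub τ).preimage (lmul τ p).continuous) hωN

end Corner

section Intertwiner

variable {K : Type*} [NormedAddCommGroup K] [InnerProductSpace ℂ K] [CompleteSpace K]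
variable {M B : VonNeumannAlgebra K} (τ : FaithfulNormalTrace M) {v : Elem M}

theorem conjJones_mem_basic (v : Elem M) : conjJones τ B v ∈ basic τ B :=
  mul_mem (mul_mem (lmul_mem_basic τ _) (jones_mem_basic τ)) (lmul_mem_basic τ _)

namespace IsIntertwiner

variable (hv : IsIntertwiner B v)

include hv

theorem range_mem : ((v * star v : Elem M) : K →L[ℂ] K) ∈ B := by
  have h := hv.conj_mem 1 (one_mem B)
  rwa [mul_one] at h

theorem star_mul_mul_star : star v * v * star v = star v := by
  simpa only [star_mul, star_star, mul_assoc] using congrArg star hv.partialIsometry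

theorem isStarProjection_source : IsStarProjection (star v * v) :=
  ⟨by rw [IsIdempotentElem, ← mul_assoc, hv.star_mul_mul_star], .star_mul_self v⟩

theorem isStarProjection_conjJones : IsStarProjection (conjJones τ B v) := by
  constructor
  · have hrange := (jones_lmul_commute τ hv.range_mem).eq
    calc conjJones τ B v * conjJones τ B v
        = lmul τ (star v) * (jones τ B * lmul τ (v * star v)) * jones τ B * lmul τ v := by
          simp only [conjJones, map_mul, mul_assoc]
      _ = lmul τ (star v * v * star v) * (jones τ B * jones τ B) * lmul τ v := by
          rw [hrange]
          simp only [map_mul, mul_assoc]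
      _ = conjJones τ B v := by
          rw [(isStarProjection_jones τ).isIdempotentElem.eq, hv.star_mul_mul_star, conjJones]
  · rw [conjJones, map_star]
    exact (isStarProjection_jones τ).isSelfAdjoint.conjugate' (lmul τ v)

theorem source_mul_conjJones :
    lmul τ (star v * v) * conjJones τ B v = conjJones τ B v := by
  rw [conjJones, ← mul_assoc, ← mul_assoc, ← map_mul, hv.star_mul_mul_star]

theorem conjJones_mul_source :
    conjJones τ B v * lmul τ (star v * v) = conjJones τ B v := by
  rw [conjJones, mul_assoc, ← map_mul, ← mul_assoc v, hv.partialIsometry]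

theorem conjJones_commute_corner {b : Elem M} (hb : (b : K →L[ℂ] K) ∈ B) :
    Commute (conjJones τ B v) (lmul τ (star v * v) * lmul τ b * lmul τ (star v * v)) := by
  have hvb : Commute (jones τ B) (lmul τ v * lmul τ b * lmul τ (star v)) := by
    simpa only [map_mul] using jones_lmul_commute τ (b := v * b * star v) (hv.conj_mem b hb)
  rw [map_mul]
  refine commute_conj_of_commute ?_ ?_ hvb
  · simpa only [map_mul] using congrArg (lmul τ) hv.partialIsometry
  · simpa only [map_mul] using congrArg (lmul τ) hv.star_mul_mul_star

theorem conjJones_mem_cutdown : conjJones τ B v ∈ cutdown τ B (star v * v) := by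
  let A : StarSubalgebra ℂ (L2 τ →L[ℂ] L2 τ) :=
    (B.toStarSubalgebra.comap M.toStarSubalgebra.subtype).map (lmul τ)
  have hA : ∀ b ∈ A, b ∈ basic τ B := by
    rintro _ ⟨b, -, rfl⟩
    exact lmul_mem_basic τ b
  have hcorner : ∀ b ∈ A,
      Commute (conjJones τ B v) (lmul τ (star v * v) * b * lmul τ (star v * v)) := by
    rintro _ ⟨b, hb, rfl⟩
    exact hv.conjJones_commute_corner τ hb
  obtain ⟨x, hx, hxp⟩ := exists_mem_centralizer_mul_eq (basic τ B) hA
    ⟨star v * v, hv.source_mem, rfl⟩ (hv.isStarProjection_source.map (lmul τ))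
    (conjJones_mem_basic τ v) hcorner
  exact ⟨x, hx, (hxp.trans (hv.conjJones_mul_source τ)).symm⟩

variable {τ}

theorem lmul_rmul_star_mem_L2Sub {ω : L2 τ} (hω : ω ∈ L2Sub τ B) :
    lmul τ v (rmul τ (star v) ω) ∈ L2Sub τ B :=
  map_mem_L2Sub τ (lmul τ v * rmul τ (star v)) (fun b hb => by
    rw [mul_apply_eq_comp, rmul_toL2, lmul_toL2, ← mul_assoc]
    exact toL2_mem_L2Sub τ (hv.conj_mem b hb)) _ hω

variable {x : L2 τ →L[ℂ] L2 τ} (hx : x ∈ relComm τ B)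

include hx

theorem lmul_source_map_toL2_star :
    lmul τ (star v * v) (x (toL2 τ (star v))) = x (toL2 τ (star v)) := by
  rw [← map_toL2_mul_of_mem_relComm hx hv.source_mem, hv.star_mul_mul_star]

theorem lmul_rmul_map_toL2_star {b : Elem M} (hb : (b : K →L[ℂ] K) ∈ B)
    (hbv : Commute b (star v * v)) :
    lmul τ b (rmul τ v (x (toL2 τ (star v)))) = rmul τ b (rmul τ v (x (toL2 τ (star v)))) := by
  have hleft : b * star v = star v * (v * b * star v) := by
    calc b * star v = b * (star v * v) * star v := by rw [mul_assoc, hv.star_mul_mul_star]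
      _ = star v * (v * b * star v) := by rw [hbv.eq]; simp only [mul_assoc]
  have hright : v * b * star v * v = v * b := by
    calc v * b * star v * v = v * (b * (star v * v)) := by simp only [mul_assoc]
      _ = v * star v * v * b := by rw [hbv.eq]; simp only [mul_assoc]
      _ = v * b := by rw [hv.partialIsometry]
  calc lmul τ b (rmul τ v (x (toL2 τ (star v))))
      = rmul τ v (x (toL2 τ (star v * (v * b * star v)))) := by
        rw [apply_comm_of_commute (lmul_rmul_commute τ _ _), ← map_toL2_mul_of_mem_relComm hx hb,
          hleft]
    _ = rmul τ (v * b * star v * v) (x (toL2 τ (star v))) := by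
        rw [map_toL2_mul_of_mem_basic hx.2 (b := v * b * star v) _ (hv.conj_mem b hb),
          rmul_mul τ _ v, mul_apply_eq_comp]
    _ = rmul τ b (rmul τ v (x (toL2 τ (star v)))) := by
        rw [hright, rmul_mul, mul_apply_eq_comp]

variable (hBM : B ≤ M)
  (hB : Set.centralizer (B : Set (K →L[ℂ] K)) ∩ (M : Set (K →L[ℂ] K)) ⊆ (B : Set (K →L[ℂ] K)))

include hBM hB

theorem rmul_map_toL2_star_mem_L2Sub : rmul τ v (x (toL2 τ (star v))) ∈ L2Sub τ B :=
  mem_L2Sub_of_commute_corner hBM hB (p := star v * v) hv.source_mem hv.isStarProjection_source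
    (by rw [apply_comm_of_commute (lmul_rmul_commute τ _ _), hv.lmul_source_map_toL2_star hx])
    fun _ hb hbv => hv.lmul_rmul_map_toL2_star hx hb hbv

theorem lmul_map_toL2_star_mem_L2Sub : lmul τ v (x (toL2 τ (star v))) ∈ L2Sub τ B := by
  have hfixed : rmul τ (star v) (rmul τ v (x (toL2 τ (star v)))) = x (toL2 τ (star v)) := by
    rw [← mul_apply_eq_comp, ← rmul_mul, ← map_toL2_mul_of_mem_basic hx.2 _ hv.range_mem,
      ← mul_assoc, hv.star_mul_mul_star]
  rw [← hfixed]
  exact hv.lmul_rmul_star_mem_L2Sub (hv.rmul_map_toL2_star_mem_L2Sub hx hBM hB)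

theorem conjJones_map_toL2_star :
    conjJones τ B v (x (toL2 τ (star v))) = x (toL2 τ (star v)) := by
  rw [conjJones, mul_apply_eq_comp, mul_apply_eq_comp, jones,
    Submodule.starProjection_eq_self_iff.mpr (hv.lmul_map_toL2_star_mem_L2Sub hx hBM hB),
    ← mul_apply_eq_comp, ← map_mul, hv.lmul_source_map_toL2_star hx]

theorem conjJones_mul_mul_conjJones :
    conjJones τ B v * x * conjJones τ B v = x * conjJones τ B v := by
  let S := conjJones τ B v * x * lmul τ (star v)
  let T := x * lmul τ (star v)
  have hST : L2Sub τ B ≤ LinearMap.eqLocus S.toLinearMap T.toLinearMap :=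
    L2Sub_le τ (isClosed_eq S.continuous T.continuous) fun b hb => by
      change conjJones τ B v (x (lmul τ (star v) (toL2 τ b))) = x (lmul τ (star v) (toL2 τ b))
      rw [lmul_toL2, map_toL2_mul_of_mem_basic hx.2 _ hb,
        apply_comm_of_commute (commute_rmul_of_mem_basic (conjJones_mem_basic τ v) hb),
        hv.conjJones_map_toL2_star hx hBM hB]
  exact ContinuousLinearMap.ext fun z =>
    hST ((L2Sub τ B).starProjection_apply_mem (lmul τ v z))

theorem conjJones_commute : Commute (conjJones τ B v) x :=
  commute_of_mul_mul_eq (hv.isStarProjection_conjJones τ).isSelfAdjoint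
    (hv.conjJones_mul_mul_conjJones hx hBM hB)
    (hv.conjJones_mul_mul_conjJones (star_mem_relComm hx) hBM hB)

end IsIntertwiner

end Intertwiner

end BasicConstruction

end

theorem lemma3p2 {K : Type*} [NormedAddCommGroup K] [InnerProductSpace ℂ K] [CompleteSpace K]
    (M B : VonNeumannAlgebra K) (hBM : B ≤ M)
    (τ : BasicConstruction.FaithfulNormalTrace M)
    (hB : Set.centralizer (B : Set (K →L[ℂ] K)) ∩ (M : Set (K →L[ℂ] K)) ⊆ (B : Set (K →L[ℂ] K)))
    (v : BasicConstruction.Elem M) (hv : BasicConstruction.IsIntertwiner B v) :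
    IsStarProjection (BasicConstruction.conjJones τ B v) ∧
      BasicConstruction.conjJones τ B v ∈ BasicConstruction.cutdown τ B (star v * v) ∧
      ∀ y ∈ BasicConstruction.cutdown τ B (star v * v),
        BasicConstruction.conjJones τ B v * y = y * BasicConstruction.conjJones τ B v := by
  refine ⟨hv.isStarProjection_conjJones τ, hv.conjJones_mem_cutdown τ, ?_⟩
  rintro _ ⟨x, hx, rfl⟩
  have hcomm := (hv.conjJones_commute hx hBM hB).eq
  rw [← mul_assoc, hcomm, mul_assoc, mul_assoc, hv.conjJones_mul_source τ,
    hv.source_mul_conjJones τ]
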